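/- Let $n\ge 1$, $s\in(0,1)$, and let $\Omega\subset\mathbb R^n$ be a nonempty bounded open set. Let $\mathcal D,\mathcal N$ be disjoint open subsets of $\mathbb R^n\setminus\overline\Omega$ with $\overline{\mathcal D\cup\mathcal N}=\mathbb R^n\setminus\Omega$ and $\Omega\cup\mathcal N$ bounded (no smoothness of the boundaries is required). Put $U=\Omega\cup\mathcal N\cup(\partial\Omega\cap\overline{\mathcal N})$, $Q=\mathbb R^{2n}\setminus(\Omega^c\times\Omega^c)$, $$\mathcal X=\{u\in H^1(\mathbb R^n):\ u|_U\in H^1_0(U),\ u=0\ \text{a.e. in } U^c\},$$ $$\langle u,v\rangle=\int_\Omega\nabla u\cdot\nabla v\,dx+\int_Q\frac{(u(x)-u(y))(v(x)-v(y))}{|x-y|^{n+2s}}\,dx\,dy ,\qquad u,v\in\mathcal X.$$ For $\lambda\in\mathbb R$ let $E_\lambda$ be the set of $u\in\mathcal X$ with $\langle u,\varphi\rangle=\lambda\int_\Omega u\varphi\,dx$ for all $\varphi\in\mathcal X$ (the eigenfunctions for $\lambda$, together with $0$); $\lambda$ is an eigenvalue if $E_\lambda\neq\{0\}$. These are the eigenvalues,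 in the weak sense, of $-\Delta+(-\Delta)^s$ in $\Omega$ with Dirichlet condition on $U^c$ and local and nonlocal Neumann conditions on $\partial\Omega\cap\overline{\mathcal N}$ and $\mathcal N$. Then every eigenvalue has finite multiplicity: $E_\lambda$ is a finite-dimensional linear space. Moreover, let $(\lambda_k)_{k\ge1}$ in $\mathbb R$ and $(e_k)_{k\ge1}$ in $\mathcal X$ be given by successive minimization, that is, for each $k\ge1$, with $\mathcal P_k=\{u\in\mathcal X:\langle u,e_j\rangle=0,\ 1\le j\le k-1\}$, $$\lambda_k=\min\{\langle u,u\rangle:\ u\in\mathcal P_k,\ \|u\|_{L^2(\Omega)}=1\},$$ and the minimum is attained at $e_k\in\mathcal P_k$, $\|e_k\|_{L^2(\Omega)}=1$. Then each $\lambda_k$ is an eigenvalue of finite multiplicity, only finitely many $\lambda_j$ are equal to $\lambda_k$, and if for some $k\ge1$ and $h\ge0$ $$\lambda_{k-1}<\lambda_k=\dots=\lambda_{k+h}<\lambda_{k+h+1}$$ (the first inequality being void for $k=1$), then $E_{\lambda_k}=\operatorname{span}\{e_k,\dots,e_{k+h}\}$. -/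

import Mathlib

open MeasureTheory Filter Topology Set
open scoped ContDiff ENNReal

/-- The Euclidean space `ℝⁿ`. -/
abbrev RSpace (n : ℕ) : Type := EuclideanSpace ℝ (Fin n)

/-- `L²(ℝⁿ)`, real valued, functions being identified when they agree almost everywhere. -/
abbrev L2 (n : ℕ) : Type := Lp ℝ 2 (volume : Measure (RSpace n))

/-- `L²(ℝⁿ; ℝⁿ)`. -/
abbrev L2Vec (n : ℕ) : Type := Lp (RSpace n) 2 (volume : Measure (RSpace n))

/-- `g` is the weak gradient of `u` on `ℝⁿ`: `∫ u ∇φ = - ∫ φ g` for all `φ ∈ C_c^∞(ℝⁿ)`. -/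
def IsWeakGradient {n : ℕ} (u : L2 n) (g : L2Vec n) : Prop :=
  ∀ φ : RSpace n → ℝ, ContDiff ℝ ∞ φ → HasCompactSupport φ →
    ∫ x, u x • gradient φ x = - ∫ x, φ x • g x

/-- `u ∈ H¹(ℝⁿ)`: `u ∈ L²(ℝⁿ)` has a weak gradient in `L²(ℝⁿ; ℝⁿ)`. -/
def MemH1 {n : ℕ} (u : L2 n) : Prop := ∃ g : L2Vec n, IsWeakGradient u g

open Classical in
/-- The weak gradient `∇u` of `u ∈ H¹(ℝⁿ)` (and `0` for the other `u`). -/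
noncomputable def weakGrad {n : ℕ} (u : L2 n) : L2Vec n :=
  if h : MemH1 u then h.choose else 0

/-- For `u ∈ H¹(ℝⁿ)`: the restriction `u|_U` is in `H¹₀(U)`, i.e. it is the limit in the norm
of `H¹(U)` of a sequence of smooth functions with compact support contained in `U`. -/
def RestrictMemH10 {n : ℕ} (U : Set (RSpace n)) (u : L2 n) : Prop :=
  ∃ φ : ℕ → RSpace n → ℝ,
    (∀ j, ContDiff ℝ ∞ (φ j) ∧ HasCompactSupport (φ j) ∧ tsupport (φ j) ⊆ U) ∧
    Tendsto (fun j => eLpNorm (fun x => u x - φ j x) 2 (volume.restrict U)) atTop (𝓝 0) ∧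
    Tendsto (fun j => eLpNorm (fun x => weakGrad u x - gradient (φ j) x) 2 (volume.restrict U))
      atTop (𝓝 0)

/-- The geometric setting: `Ω` is a nonempty bounded open set; `D` (Dirichlet) and `N` (Neumann)
are disjoint open subsets of `ℝⁿ \ closure Ω` such that `closure (D ∪ N) = ℝⁿ \ Ω`, and `Ω ∪ N`
is bounded. -/
structure IsMixedSetting {n : ℕ} (Ω D N : Set (RSpace n)) : Prop where
  isOpen_domain : IsOpen Ω
  nonempty_domain : Ω.Nonempty
  isOpen_dirichlet : IsOpen D
  isOpen_neumann : IsOpen N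
  dirichlet_subset : D ⊆ (closure Ω)ᶜ
  neumann_subset : N ⊆ (closure Ω)ᶜ
  disjoint : Disjoint D N
  closure_union : closure (D ∪ N) = Ωᶜ
  isBounded : Bornology.IsBounded (Ω ∪ N)

/-- `U = Ω ∪ N ∪ (∂Ω ∩ closure N)`. -/
def mixedU {n : ℕ} (Ω N : Set (RSpace n)) : Set (RSpace n) :=
  Ω ∪ N ∪ (frontier Ω ∩ closure N)

/-- The space `X = {u ∈ H¹(ℝⁿ) : u|_U ∈ H¹₀(U), u = 0 a.e. in Uᶜ}`. -/
def spaceX {n : ℕ} (Ω N : Set (RSpace n)) : Set (L2 n) :=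
  {u | MemH1 u ∧ RestrictMemH10 (mixedU Ω N) u ∧ ∀ᵐ x, x ∉ mixedU Ω N → u x = 0}

/-- The set `Q = ℝ²ⁿ \ (Ωᶜ × Ωᶜ)`. -/
def setQ {n : ℕ} (Ω : Set (RSpace n)) : Set (RSpace n × RSpace n) := (Ωᶜ ×ˢ Ωᶜ)ᶜ

/-- The inner product of `X`:
`⟨u, v⟩ = ∫_Ω ∇u · ∇v dx + ∫_Q (u(x) - u(y)) (v(x) - v(y)) / |x - y|^(n + 2s) dx dy`. -/
noncomputable def energy {n : ℕ} (s : ℝ) (Ω : Set (RSpace n)) (u v : L2 n) : ℝ :=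
  (∫ x in Ω, inner ℝ (weakGrad u x) (weakGrad v x)) +
    ∫ p in setQ Ω, (u p.1 - u p.2) * (v p.1 - v p.2) / ‖p.1 - p.2‖ ^ ((n : ℝ) + 2 * s)

/-- The weak solutions `u ∈ X` (the zero function included) of the mixed problem with
parameter `lam`: `⟨u, φ⟩ = lam ∫_Ω u φ dx` for all `φ ∈ X`. -/
def eigenSet {n : ℕ} (s : ℝ) (Ω N : Set (RSpace n)) (lam : ℝ) : Set (L2 n) :=
  {u | u ∈ spaceX Ω N ∧ ∀ φ ∈ spaceX Ω N, energy s Ω u φ = lam * ∫ x in Ω, u x * φ x}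

/-- `lam` is an eigenvalue: it has a weak solution that is not zero. -/
def IsMixedEigenvalue {n : ℕ} (s : ℝ) (Ω N : Set (RSpace n)) (lam : ℝ) : Prop :=
  ∃ u ∈ eigenSet s Ω N lam, u ≠ 0

/-- `lam` has finite multiplicity: its weak solutions form a linear space of finite dimension. -/
def HasFiniteMultiplicity {n : ℕ} (s : ℝ) (Ω N : Set (RSpace n)) (lam : ℝ) : Prop :=
  ∃ V : Submodule ℝ (L2 n), (V : Set (L2 n)) = eigenSet s Ω N lam ∧ FiniteDimensional ℝ V

/-- `P_k = {u ∈ X : ⟨u, e_j⟩ = 0 for j = 1, …, k - 1}`; in particular `P_1 = X`. -/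
def spaceP {n : ℕ} (s : ℝ) (Ω N : Set (RSpace n)) (e : ℕ → L2 n) (k : ℕ) : Set (L2 n) :=
  {u | u ∈ spaceX Ω N ∧ ∀ j, 1 ≤ j → j < k → energy s Ω u (e j) = 0}

/-- `(lam k)` and `(e k)`, `k = 1, 2, …`, are the numbers and functions given by successive
minimization: `lam k` is the minimum of `⟨u, u⟩` over the `u ∈ P_k` with `‖u‖_{L²(Ω)} = 1`, and
it is attained at `e k`. The terms with index `0` play no role. -/
def IsMinimizingSystem {n : ℕ} (s : ℝ) (Ω N : Set (RSpace n)) (lam : ℕ → ℝ) (e : ℕ → L2 n) :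
    Prop :=
  ∀ k, 1 ≤ k →
    e k ∈ spaceP s Ω N e k ∧ ∫ x in Ω, (e k x) ^ 2 = 1 ∧ energy s Ω (e k) (e k) = lam k ∧
    ∀ u ∈ spaceP s Ω N e k, ∫ x in Ω, (u x) ^ 2 = 1 → lam k ≤ energy s Ω u u

/-! On `X` the energy `a` and the mass `b` are symmetric nonnegative forms, and `E_λ` is the kernel
of `a - λ b`. The spectral statements rest on two facts: `a` is definite, and for every `ε > 0`
finitely many linear conditions force `b u u ≤ ε * a u u`. The second fact takes the place of a
compact embedding into `L²(Ω)`: for small `ε` these conditions are jointly injective on `E_λ`.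

Both facts come from the nonlocal term alone. If `u` has mean zero on a ball `B` of radius `r`
containing `x`, then `|B| u(x)² ≤ ∫_B (u(x) - u(y))² dy ≤ (2r)^(n+2s) ∫ (u(x) - u(y))² / |x -
y|^(n+2s) dy`, and `(2r)^(n+2s) / |B|` is a constant times `r^(2s)`. Vanishing means on finitely
many small balls covering `Ω` are the conditions (`exists_linearMap_massForm_le`). Since `Q`
contains `Ω × ℝⁿ`, the balls may cross `∂Ω`, and no regularity of the boundary enters. Zero energy
makes `u` constant, hence zero in `L²(ℝⁿ)`.

The double integral is finite on `X`: approximation by test functions gives `‖u(· + z) - u‖ ≤ |z|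
‖∇u‖` (`exists_eLpNorm_translate_sub_le`), and `min(|z|², 1) / |z|^(n+2s)` is integrable for `0 < s
< 1`.

For the minimizers, the first variation gives the weak equation against `P_k`, and induction on `k`
extends it to `X`. An element of `E_{λ_k}` minus its projection on `e_k, …, e_{k+h}` is admissible
for the minimization of index `k + h + 1`, whose strictly larger minimum forces it to vanish. -/

/-- The weak eigenvectors of `a` relative to `b` for the parameter `μ`. -/
def relEigenspace {V : Type*} [AddCommGroup V] [Module ℝ V] (a b : LinearMap.BilinForm ℝ V)
    (μ : ℝ) : Submodule ℝ V :=
  LinearMap.ker (a - μ • b)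

theorem mem_relEigenspace {V : Type*} [AddCommGroup V] [Module ℝ V]
    {a b : LinearMap.BilinForm ℝ V} {μ : ℝ} {u : V} :
    u ∈ relEigenspace a b μ ↔ ∀ v, a u v = μ * b u v := by
  simp only [relEigenspace, LinearMap.mem_ker, LinearMap.ext_iff, LinearMap.sub_apply,
    LinearMap.smul_apply, smul_eq_mul, sub_eq_zero]

/-- Successive minimization of `a u u` on the unit sphere of `b`. -/
def IsRelMinimizing {V : Type*} [AddCommGroup V] [Module ℝ V] (a b : LinearMap.BilinForm ℝ V)
    (lam : ℕ → ℝ) (e : ℕ → V) : Prop :=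
  ∀ k, 1 ≤ k → (∀ j, 1 ≤ j → j < k → a (e k) (e j) = 0) ∧ b (e k) (e k) = 1 ∧
    a (e k) (e k) = lam k ∧
    ∀ u, (∀ j, 1 ≤ j → j < k → a u (e j) = 0) → b u u = 1 → lam k ≤ a u u

/-! ### Spectral theory of a pair of symmetric forms. -/

section abstractForms

variable {V : Type*} [AddCommGroup V] [Module ℝ V] {a b : LinearMap.BilinForm ℝ V}
  {lam : ℕ → ℝ} {e : ℕ → V}

/-- A space of relative eigenvectors is finite dimensional as soon as finitely many linear
conditions make `b` small with respect to `a`. -/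
theorem finiteDimensional_relEigenspace (hb : ∀ u, 0 ≤ b u u) (hpos : ∀ u, a u u = 0 → u = 0)
    (hcpt : ∀ ε : ℝ, 0 < ε → ∃ (ι : Type) (_ : Finite ι) (T : V →ₗ[ℝ] (ι → ℝ)),
      ∀ u, T u = 0 → b u u ≤ ε * a u u) (μ : ℝ) :
    FiniteDimensional ℝ (relEigenspace a b μ) := by
  -- With this `ε`, an eigenvector killed by `T` satisfies `b u u ≤ ε * μ * b u u ≤ b u u / 2`.
  have hε : 0 < 1 / (2 * (|μ| + 1)) := by positivity
  obtain ⟨ι, _, T, hT⟩ := hcpt _ hε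
  refine FiniteDimensional.of_injective (T.comp (relEigenspace a b μ).subtype) ?_
  rw [← LinearMap.ker_eq_bot, LinearMap.ker_eq_bot']
  rintro ⟨u, hu⟩ h0
  have h1 := hT u h0
  have h2 := mem_relEigenspace.1 hu u
  have hbu : b u u = 0 := by
    rw [h2, div_mul_eq_mul_div, one_mul, le_div_iff₀ (by positivity)] at h1
    nlinarith [hb u, le_abs_self μ, mul_nonneg (hb u) (abs_nonneg μ),
      mul_le_mul_of_nonneg_right (le_abs_self μ) (hb u)]
  exact Subtype.ext (hpos u (by rw [h2, hbu, mul_zero]))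

theorem IsRelMinimizing.pos (h : IsRelMinimizing a b lam e) (ha : ∀ u, 0 ≤ a u u)
    (hpos : ∀ u, a u u = 0 → u = 0) {k : ℕ} (hk : 1 ≤ k) : 0 < lam k := by
  obtain ⟨-, h1, h2, -⟩ := h k hk
  rw [← h2]
  refine lt_of_le_of_ne (ha _) fun h0 => ?_
  simp [hpos _ h0.symm] at h1

theorem IsRelMinimizing.ortho (h : IsRelMinimizing a b lam e) (hsymm : ∀ u v, a u v = a v u)
    {i j : ℕ} (hi : 1 ≤ i) (hj : 1 ≤ j) (hij : i ≠ j) : a (e i) (e j) = 0 := by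
  rcases lt_or_gt_of_ne hij with hlt | hlt
  · rw [hsymm]; exact (h j hj).1 i hi hlt
  · exact (h i hi).1 j hj hlt

/-- The vector `e (k + 1)` is a competitor in the minimization that defines `lam k`. -/
theorem IsRelMinimizing.le_succ (h : IsRelMinimizing a b lam e) {k : ℕ} (hk : 1 ≤ k) :
    lam k ≤ lam (k + 1) := by
  obtain ⟨h0, h1, h2, -⟩ := h (k + 1) (by omega)
  rw [← h2]
  exact (h k hk).2.2.2 _ (fun j hj hjk => h0 j hj (by omega)) h1

theorem IsRelMinimizing.mono (h : IsRelMinimizing a b lam e) {j k : ℕ} (hj : 1 ≤ j)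
    (hjk : j ≤ k) : lam j ≤ lam k := by
  induction k, hjk using Nat.le_induction with
  | base => exact le_rfl
  | succ k hk ih => exact ih.trans (h.le_succ (hj.trans hk))

/-- The minimality bound for vectors that are not normalized. -/
theorem IsRelMinimizing.mul_le (h : IsRelMinimizing a b lam e) (ha : ∀ u, 0 ≤ a u u)
    (hb : ∀ u, 0 ≤ b u u) {k : ℕ} (hk : 1 ≤ k) {u : V}
    (hu : ∀ j, 1 ≤ j → j < k → a u (e j) = 0) : lam k * b u u ≤ a u u := by
  rcases (hb u).eq_or_lt with h0 | h0
  · rw [← h0, mul_zero]; exact ha u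
  · set c := (Real.sqrt (b u u))⁻¹ with hc
    have hcc : c * c = (b u u)⁻¹ := by
      rw [hc, ← mul_inv, Real.mul_self_sqrt h0.le]
    have := (h k hk).2.2.2 (c • u) (fun j hj hjk => by simp [hu j hj hjk])
      (by simp only [map_smul, LinearMap.smul_apply, smul_eq_mul, ← mul_assoc, hcc]
          exact inv_mul_cancel₀ h0.ne')
    simp only [map_smul, LinearMap.smul_apply, smul_eq_mul, ← mul_assoc, hcc] at this
    rwa [inv_mul_eq_div, le_div_iff₀ h0] at this

theorem eq_zero_of_forall_quadratic_nonneg {p q : ℝ} (h : ∀ t : ℝ, 0 ≤ 2 * t * p + t ^ 2 * q) :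
    p = 0 := by
  -- At this `t` the linear term outweighs the quadratic one whatever the sign of `q`, so the value
  -- is negative unless `p = 0`.
  have h1 := h (-p / (|q| + 1))
  have hq : 0 < |q| + 1 := by positivity
  have h2 : 2 * (-p / (|q| + 1)) * p + (-p / (|q| + 1)) ^ 2 * q
      = p ^ 2 * (q - 2 * (|q| + 1)) / (|q| + 1) ^ 2 := by
    field_simp
    ring
  rw [h2] at h1
  have h3 : 0 ≤ p ^ 2 * (q - 2 * (|q| + 1)) := by
    by_contra hneg
    exact absurd h1 (not_le.2 (div_neg_of_neg_of_pos (not_le.1 hneg) (by positivity)))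
  have h4 : q - 2 * (|q| + 1) < 0 := by linarith [le_abs_self q, abs_nonneg q]
  have h5 : p ^ 2 ≤ 0 := by
    by_contra hp
    exact absurd h3 (not_le.2 (mul_neg_of_pos_of_neg (not_le.1 hp) h4))
  exact pow_eq_zero_iff (two_ne_zero) |>.1 (le_antisymm h5 (sq_nonneg p))

/-- First variation: `a - lam k • b` is nonnegative at every `e k + t • v` and vanishes at `t = 0`,
so its linear coefficient in `t` is zero. -/
theorem IsRelMinimizing.apply_eq (h : IsRelMinimizing a b lam e) (hsymm : ∀ u v, a u v = a v u)
    (hbsymm : ∀ u v, b u v = b v u) (ha : ∀ u, 0 ≤ a u u) (hb : ∀ u, 0 ≤ b u u)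
    {k : ℕ} (hk : 1 ≤ k) {v : V} (hv : ∀ j, 1 ≤ j → j < k → a v (e j) = 0) :
    a (e k) v = lam k * b (e k) v := by
  obtain ⟨h0, h1, h2, -⟩ := h k hk
  rw [← sub_eq_zero]
  refine eq_zero_of_forall_quadratic_nonneg (q := a v v - lam k * b v v) fun t => ?_
  have := h.mul_le ha hb hk (u := e k + t • v)
    (fun j hj hjk => by simp [h0 j hj hjk, hv j hj hjk])
  simp only [map_add, map_smul, LinearMap.add_apply, LinearMap.smul_apply, smul_eq_mul, h1, h2,
    hsymm v (e k), hbsymm v (e k)] at this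
  linarith

/-- Subtraction of the `a`-orthogonal projection on the span of finitely many `e j`. -/
theorem IsRelMinimizing.apply_sub_sum (h : IsRelMinimizing a b lam e)
    (hsymm : ∀ u v, a u v = a v u) (ha : ∀ u, 0 ≤ a u u) (hpos : ∀ u, a u u = 0 → u = 0)
    {S : Finset ℕ} (hS : ∀ j ∈ S, 1 ≤ j) (u : V) {i : ℕ} (hi : i ∈ S) :
    a (u - ∑ j ∈ S, (a u (e j) / lam j) • e j) (e i) = 0 := by
  have : ∀ j ∈ S, j ≠ i → a ((a u (e j) / lam j) • e j) (e i) = 0 := fun j hj hji => by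
    simp [h.ortho hsymm (hS j hj) (hS i hi) hji]
  rw [map_sub, map_sum, LinearMap.sub_apply, LinearMap.sum_apply,
    Finset.sum_eq_single_of_mem i hi this, map_smul, LinearMap.smul_apply, (h i (hS i hi)).2.2.1,
    smul_eq_mul, div_mul_cancel₀ _ (h.pos ha hpos (hS i hi)).ne', sub_self]

/-- The first variation only allows test vectors orthogonal to the earlier minimizers. The missing
directions `e j` contribute nothing to either side, because the earlier `e j` are already known to
be eigenvectors. -/
theorem IsRelMinimizing.mem_relEigenspace (h : IsRelMinimizing a b lam e)
    (hsymm : ∀ u v, a u v = a v u) (hbsymm : ∀ u v, b u v = b v u) (ha : ∀ u, 0 ≤ a u u)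
    (hb : ∀ u, 0 ≤ b u u) (hpos : ∀ u, a u u = 0 → u = 0) (k : ℕ) (hk : 1 ≤ k) :
    e k ∈ relEigenspace a b (lam k) := by
  induction k using Nat.strong_induction_on with
  | _ k ih =>
    refine _root_.mem_relEigenspace.2 fun φ => ?_
    have hS : ∀ j ∈ Finset.Ico 1 k, 1 ≤ j := fun j hj => (Finset.mem_Ico.1 hj).1
    set v := φ - ∑ j ∈ Finset.Ico 1 k, (a φ (e j) / lam j) • e j with hv
    have key := h.apply_eq hsymm hbsymm ha hb hk (v := v) fun j hj hjk =>
      h.apply_sub_sum hsymm ha hpos hS φ (Finset.mem_Ico.2 ⟨hj, hjk⟩)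
    -- Here `0 = a (e j) (e k) = lam j * b (e j) (e k)` with `lam j > 0`.
    have hbz : ∀ j ∈ Finset.Ico 1 k, b (e k) (e j) = 0 := fun j hj => by
      have hj' := Finset.mem_Ico.1 hj
      have := _root_.mem_relEigenspace.1 (ih j hj'.2 hj'.1) (e k)
      rw [h.ortho hsymm hj'.1 hk hj'.2.ne, eq_comm, mul_eq_zero] at this
      rw [hbsymm]
      exact this.resolve_left (h.pos ha hpos hj'.1).ne'
    have haz : ∀ j ∈ Finset.Ico 1 k, a (e k) (e j) = 0 := fun j hj => by
      have hj' := Finset.mem_Ico.1 hj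
      exact h.ortho hsymm hk hj'.1 hj'.2.ne'
    have e1 : ∀ c : LinearMap.BilinForm ℝ V, (∀ j ∈ Finset.Ico 1 k, c (e k) (e j) = 0) →
        c (e k) v = c (e k) φ := fun c hc => by
      rw [hv, map_sub, map_sum, Finset.sum_eq_zero, sub_zero]
      intro j hj
      rw [map_smul, hc j hj, smul_zero]
    rwa [e1 a haz, e1 b hbz] at key

/-- A value is taken only finitely often, since the minimizers are linearly independent. -/
theorem IsRelMinimizing.finite_setOf_eq (h : IsRelMinimizing a b lam e)
    (hsymm : ∀ u v, a u v = a v u) (hbsymm : ∀ u v, b u v = b v u) (ha : ∀ u, 0 ≤ a u u)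
    (hb : ∀ u, 0 ≤ b u u) (hpos : ∀ u, a u u = 0 → u = 0) (μ : ℝ)
    [FiniteDimensional ℝ (relEigenspace a b μ)] : {j : ℕ | 1 ≤ j ∧ lam j = μ}.Finite := by
  have hmem : ∀ j, 1 ≤ j ∧ lam j = μ → e j ∈ relEigenspace a b μ := by
    rintro j ⟨hj, rfl⟩
    exact h.mem_relEigenspace hsymm hbsymm ha hb hpos j hj
  let f : {j : ℕ | 1 ≤ j ∧ lam j = μ} → relEigenspace a b μ := fun j => ⟨e j, hmem j j.2⟩
  have hli : LinearIndependent ℝ f := by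
    refine LinearIndependent.of_comp (relEigenspace a b μ).subtype ?_
    refine LinearMap.BilinForm.linearIndependent_of_iIsOrtho (B := a) ?_ ?_
    · intro i j hij
      exact h.ortho hsymm i.2.1 j.2.1 (fun h => hij (Subtype.ext h))
    · intro i hi
      have h1 : a (e i) (e i) = 0 := hi
      rw [(h i i.2.1).2.2.1] at h1
      exact (h.pos ha hpos i.2.1).ne' h1
  exact hli.finite

/-- The remainder `u - p` is an eigenvector for `lam k` that is orthogonal to every `e j` with `j ≤
k + m`. Its Rayleigh quotient would be both `lam k` and at least `lam (k + m + 1)`, unless it is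
zero. -/
theorem IsRelMinimizing.relEigenspace_eq_span (h : IsRelMinimizing a b lam e)
    (hsymm : ∀ u v, a u v = a v u) (hbsymm : ∀ u v, b u v = b v u) (ha : ∀ u, 0 ≤ a u u)
    (hb : ∀ u, 0 ≤ b u u) (hpos : ∀ u, a u u = 0 → u = 0) {k m : ℕ} (hk : 1 ≤ k)
    (hlt : 2 ≤ k → lam (k - 1) < lam k) (heq : ∀ j, k ≤ j → j ≤ k + m → lam j = lam k)
    (hlt' : lam (k + m) < lam (k + m + 1)) :
    relEigenspace a b (lam k) = Submodule.span ℝ (e '' Set.Icc k (k + m)) := by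
  have hmem : ∀ j ∈ Finset.Icc k (k + m), e j ∈ relEigenspace a b (lam k) := fun j hj => by
    have hj' := Finset.mem_Icc.1 hj
    rw [← heq j hj'.1 hj'.2]
    exact h.mem_relEigenspace hsymm hbsymm ha hb hpos j (hk.trans hj'.1)
  apply le_antisymm
  · intro u hu
    set p := ∑ j ∈ Finset.Icc k (k + m), (a u (e j) / lam j) • e j with hp
    have hps : p ∈ Submodule.span ℝ (e '' Set.Icc k (k + m)) :=
      Submodule.sum_mem _ fun j hj => Submodule.smul_mem _ _
        (Submodule.subset_span ⟨j, by simpa using hj, rfl⟩)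
    have hw : u - p ∈ relEigenspace a b (lam k) :=
      Submodule.sub_mem _ hu (Submodule.sum_mem _ fun j hj => Submodule.smul_mem _ _ (hmem j hj))
    have hort : ∀ j, 1 ≤ j → j < k + m + 1 → a (u - p) (e j) = 0 := by
      intro j hj hjm
      by_cases hjk : k ≤ j
      · exact h.apply_sub_sum hsymm ha hpos (fun i hi => hk.trans (Finset.mem_Icc.1 hi).1) u
          (Finset.mem_Icc.2 ⟨hjk, by omega⟩)
      -- Eigenvectors for distinct values are orthogonal. Since `1 ≤ j < k`, the case `2 ≤ k` needed
      -- for the first gap holds.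
      · have h1 := _root_.mem_relEigenspace.1 hw (e j)
        have h2 := _root_.mem_relEigenspace.1
          (h.mem_relEigenspace hsymm hbsymm ha hb hpos j hj) (u - p)
        rw [hsymm, hbsymm] at h2
        have h3 : lam j < lam k := (h.mono hj (by omega : j ≤ k - 1)).trans_lt (hlt (by omega))
        have h4 : (lam k - lam j) * b (u - p) (e j) = 0 := by linarith
        rw [h1, (mul_eq_zero.1 h4).resolve_left (sub_pos.2 h3).ne', mul_zero]
    have h1 := h.mul_le ha hb (k := k + m + 1) (by omega) hort
    have h2 := _root_.mem_relEigenspace.1 hw (u - p)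
    rw [heq (k + m) (by omega) le_rfl] at hlt'
    have h3 : b (u - p) (u - p) = 0 := by
      have := hb (u - p)
      by_contra hne
      have := mul_lt_mul_of_pos_right hlt' (lt_of_le_of_ne this (Ne.symm hne))
      linarith
    have h4 : u - p = 0 := hpos _ (by rw [h2, h3, mul_zero])
    rw [sub_eq_zero.1 h4]
    exact hps
  · rw [Submodule.span_le]
    rintro _ ⟨j, hj, rfl⟩
    exact hmem j (by simpa using hj)

end abstractForms

/-! ### Classical gradients of test functions. -/

section gradient

variable {n : ℕ}

theorem gradient_add_fun {φ ψ : RSpace n → ℝ} {x : RSpace n} (hφ : DifferentiableAt ℝ φ x)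
    (hψ : DifferentiableAt ℝ ψ x) :
    gradient (fun y => φ y + ψ y) x = gradient φ x + gradient ψ x := by
  simp only [gradient, fderiv_fun_add hφ hψ, map_add]

theorem gradient_const_mul_fun {φ : RSpace n → ℝ} {x : RSpace n} (c : ℝ)
    (hφ : DifferentiableAt ℝ φ x) :
    gradient (fun y => c * φ y) x = c • gradient φ x := by
  simp only [gradient, fderiv_const_mul hφ, map_smul]

theorem continuous_gradient {φ : RSpace n → ℝ} (hφ : ContDiff ℝ ∞ φ) :
    Continuous (gradient φ) :=
  (InnerProductSpace.toDual ℝ (RSpace n)).symm.continuous.comp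
    (hφ.continuous_fderiv (by simp))

theorem gradient_eq_zero_of_notMem_tsupport {φ : RSpace n → ℝ} {x : RSpace n}
    (hx : x ∉ tsupport φ) : gradient φ x = 0 := by
  have : fderiv ℝ φ x = 0 := by
    by_contra h
    exact hx (support_fderiv_subset ℝ h)
  simp [gradient, this]

theorem hasCompactSupport_gradient {φ : RSpace n → ℝ} (hφ : HasCompactSupport φ) :
    HasCompactSupport (gradient φ) :=
  HasCompactSupport.intro hφ fun _ hx => gradient_eq_zero_of_notMem_tsupport hx

end gradient

/-! ### Uniqueness and linearity of the weak gradient. -/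

section weakGradient

variable {n : ℕ}

theorem integrable_L2_smul_gradient (u : L2 n) {φ : RSpace n → ℝ} (hφ : ContDiff ℝ ∞ φ)
    (hc : HasCompactSupport φ) : Integrable fun x => u x • gradient φ x :=
  memLp_one_iff_integrable.1 (((continuous_gradient hφ).memLp_of_hasCompactSupport (p := 2)
    (hasCompactSupport_gradient hc)).smul (Lp.memLp u) (r := 1))

theorem integrable_smul_L2Vec (g : L2Vec n) {φ : RSpace n → ℝ} (hφ : ContDiff ℝ ∞ φ)
    (hc : HasCompactSupport φ) : Integrable fun x => φ x • g x :=
  memLp_one_iff_integrable.1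
    ((Lp.memLp g).smul (hφ.continuous.memLp_of_hasCompactSupport (p := 2) hc) (r := 1))

/-- Since `weakGrad` is an arbitrary choice, uniqueness is what makes it linear on `H¹`. -/
theorem IsWeakGradient.unique {u : L2 n} {g g' : L2Vec n} (h : IsWeakGradient u g)
    (h' : IsWeakGradient u g') : g = g' := by
  have key : ∀ᵐ x, (g - g' : L2Vec n) x = 0 := by
    refine ae_eq_zero_of_integral_contDiff_smul_eq_zero
      ((Lp.memLp (g - g')).locallyIntegrable (by norm_num)) fun φ hφ hc => ?_
    have h1 : ∫ x, φ x • (g - g' : L2Vec n) x = ∫ x, (φ x • g x - φ x • g' x) := by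
      refine integral_congr_ae ?_
      filter_upwards [Lp.coeFn_sub g g'] with x hx
      rw [hx, Pi.sub_apply, smul_sub]
    rw [h1, integral_sub (integrable_smul_L2Vec g hφ hc) (integrable_smul_L2Vec g' hφ hc),
      sub_eq_zero, ← neg_inj, ← h φ hφ hc, ← h' φ hφ hc]
  exact sub_eq_zero.1 ((Lp.eq_zero_iff_ae_eq_zero).2 key)

theorem IsWeakGradient.add {u v : L2 n} {g g' : L2Vec n} (h : IsWeakGradient u g)
    (h' : IsWeakGradient v g') : IsWeakGradient (u + v) (g + g') := by
  intro φ hφ hc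
  have h1 : ∫ x, (u + v : L2 n) x • gradient φ x
      = ∫ x, (u x • gradient φ x + v x • gradient φ x) := by
    refine integral_congr_ae ?_
    filter_upwards [Lp.coeFn_add u v] with x hx
    rw [hx, Pi.add_apply, add_smul]
  have h2 : ∫ x, φ x • (g + g' : L2Vec n) x = ∫ x, (φ x • g x + φ x • g' x) := by
    refine integral_congr_ae ?_
    filter_upwards [Lp.coeFn_add g g'] with x hx
    rw [hx, Pi.add_apply, smul_add]
  rw [h1, h2, integral_add (integrable_L2_smul_gradient u hφ hc)
    (integrable_L2_smul_gradient v hφ hc), integral_add (integrable_smul_L2Vec g hφ hc)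
    (integrable_smul_L2Vec g' hφ hc), h φ hφ hc, h' φ hφ hc, neg_add]

theorem IsWeakGradient.smul {u : L2 n} {g : L2Vec n} (c : ℝ) (h : IsWeakGradient u g) :
    IsWeakGradient (c • u) (c • g) := by
  intro φ hφ hc
  have h1 : ∫ x, (c • u : L2 n) x • gradient φ x = ∫ x, c • (u x • gradient φ x) := by
    refine integral_congr_ae ?_
    filter_upwards [Lp.coeFn_smul c u] with x hx
    rw [hx, Pi.smul_apply, smul_assoc]
  have h2 : ∫ x, φ x • (c • g : L2Vec n) x = ∫ x, c • (φ x • g x) := by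
    refine integral_congr_ae ?_
    filter_upwards [Lp.coeFn_smul c g] with x hx
    rw [hx, Pi.smul_apply, smul_comm]
  rw [h1, h2, integral_smul, integral_smul, h φ hφ hc, smul_neg]

theorem MemH1.isWeakGradient {u : L2 n} (h : MemH1 u) : IsWeakGradient u (weakGrad u) := by
  rw [weakGrad, dif_pos h]
  exact h.choose_spec

theorem IsWeakGradient.weakGrad_eq {u : L2 n} {g : L2Vec n} (h : IsWeakGradient u g) :
    weakGrad u = g :=
  (MemH1.isWeakGradient ⟨g, h⟩).unique h

theorem MemH1.weakGrad_add {u v : L2 n} (hu : MemH1 u) (hv : MemH1 v) :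
    weakGrad (u + v) = weakGrad u + weakGrad v :=
  (hu.isWeakGradient.add hv.isWeakGradient).weakGrad_eq

theorem MemH1.weakGrad_smul {u : L2 n} (c : ℝ) (hu : MemH1 u) :
    weakGrad (c • u) = c • weakGrad u :=
  (hu.isWeakGradient.smul c).weakGrad_eq

theorem memH1_zero : MemH1 (0 : L2 n) := by
  refine ⟨0, fun φ hφ hc => ?_⟩
  rw [integral_eq_zero_of_ae, integral_eq_zero_of_ae, neg_zero]
  · filter_upwards [Lp.coeFn_zero (RSpace n) 2 volume] with x hx
    simp
  · filter_upwards [Lp.coeFn_zero ℝ 2 volume] with x hx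
    simp

end weakGradient

/-! ### Linear structure of `X`. -/

section spaceX

variable {n : ℕ} {U : Set (RSpace n)}

theorem tendsto_eLpNorm_add {ι E : Type*} [NormedAddCommGroup E] {l : Filter ι}
    {μ : Measure (RSpace n)} {f g : ι → RSpace n → E} {h : ι → RSpace n → E}
    (hf : ∀ i, AEStronglyMeasurable (f i) μ) (hg : ∀ i, AEStronglyMeasurable (g i) μ)
    (hh : ∀ i, h i =ᵐ[μ] f i + g i)
    (hf0 : Tendsto (fun i => eLpNorm (f i) 2 μ) l (𝓝 0))
    (hg0 : Tendsto (fun i => eLpNorm (g i) 2 μ) l (𝓝 0)) :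
    Tendsto (fun i => eLpNorm (h i) 2 μ) l (𝓝 0) := by
  refine tendsto_of_tendsto_of_tendsto_of_le_of_le tendsto_const_nhds
    (by simpa using hf0.add hg0) (fun i => zero_le) fun i => ?_
  dsimp only
  rw [eLpNorm_congr_ae (hh i)]
  exact eLpNorm_add_le (hf i) (hg i) (by norm_num)

theorem tendsto_eLpNorm_const_smul {ι E : Type*} [NormedAddCommGroup E] [NormedSpace ℝ E]
    {l : Filter ι} {μ : Measure (RSpace n)} {f h : ι → RSpace n → E} (c : ℝ)
    (hh : ∀ i, h i =ᵐ[μ] c • f i) (hf0 : Tendsto (fun i => eLpNorm (f i) 2 μ) l (𝓝 0)) :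
    Tendsto (fun i => eLpNorm (h i) 2 μ) l (𝓝 0) := by
  have : (fun i => eLpNorm (h i) 2 μ) = fun i => ‖c‖ₑ * eLpNorm (f i) 2 μ := by
    funext i
    rw [eLpNorm_congr_ae (hh i), eLpNorm_const_smul]
  rw [this]
  simpa using ENNReal.Tendsto.const_mul hf0 (Or.inr enorm_ne_top)

theorem RestrictMemH10.add {u v : L2 n} (hu : MemH1 u) (hv : MemH1 v)
    (h : RestrictMemH10 U u) (h' : RestrictMemH10 U v) : RestrictMemH10 U (u + v) := by
  obtain ⟨φ, hφ, h1, h2⟩ := h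
  obtain ⟨ψ, hψ, h3, h4⟩ := h'
  refine ⟨fun j x => φ j x + ψ j x, fun j => ⟨(hφ j).1.add (hψ j).1,
    (hφ j).2.1.add (hψ j).2.1, (tsupport_add _ _).trans (union_subset (hφ j).2.2 (hψ j).2.2)⟩,
    ?_, ?_⟩
  · refine tendsto_eLpNorm_add
      (fun j => (Lp.aestronglyMeasurable u).restrict.sub
        (hφ j).1.continuous.aestronglyMeasurable)
      (fun j => (Lp.aestronglyMeasurable v).restrict.sub
        (hψ j).1.continuous.aestronglyMeasurable) (fun j => ?_) h1 h3
    filter_upwards [ae_restrict_of_ae (Lp.coeFn_add u v)] with x hx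
    simp only [hx, Pi.add_apply]
    exact add_sub_add_comm _ _ _ _
  · refine tendsto_eLpNorm_add
      (fun j => (Lp.aestronglyMeasurable _).restrict.sub
        (continuous_gradient (hφ j).1).aestronglyMeasurable)
      (fun j => (Lp.aestronglyMeasurable _).restrict.sub
        (continuous_gradient (hψ j).1).aestronglyMeasurable) (fun j => ?_) h2 h4
    rw [hu.weakGrad_add hv]
    filter_upwards [ae_restrict_of_ae (Lp.coeFn_add (weakGrad u) (weakGrad v))] with x hx
    simp only [hx, Pi.add_apply]
    rw [gradient_add_fun ((hφ j).1.differentiable (by simp) x)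
      ((hψ j).1.differentiable (by simp) x)]
    exact add_sub_add_comm _ _ _ _

theorem RestrictMemH10.smul {u : L2 n} (c : ℝ) (hu : MemH1 u) (h : RestrictMemH10 U u) :
    RestrictMemH10 U (c • u) := by
  obtain ⟨φ, hφ, h1, h2⟩ := h
  refine ⟨fun j x => c * φ j x, fun j => ⟨contDiff_const.mul (hφ j).1,
    (hφ j).2.1.mul_left, (tsupport_mul_subset_right).trans (hφ j).2.2⟩, ?_, ?_⟩
  · refine tendsto_eLpNorm_const_smul c (fun j => ?_) h1
    filter_upwards [ae_restrict_of_ae (Lp.coeFn_smul c u)] with x hx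
    simp only [hx, Pi.smul_apply, smul_eq_mul, mul_sub]
  · refine tendsto_eLpNorm_const_smul c (fun j => ?_) h2
    rw [hu.weakGrad_smul c]
    filter_upwards [ae_restrict_of_ae (Lp.coeFn_smul c (weakGrad u))] with x hx
    simp only [hx, Pi.smul_apply]
    rw [gradient_const_mul_fun c ((hφ j).1.differentiable (by simp) x), smul_sub]

theorem restrictMemH10_zero : RestrictMemH10 U (0 : L2 n) := by
  have hw : weakGrad (0 : L2 n) = 0 := by
    simpa using (memH1_zero (n := n)).weakGrad_smul 0
  refine ⟨fun _ _ => 0, fun j => ⟨contDiff_const, HasCompactSupport.zero, by simp [tsupport]⟩,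
    ?_, ?_⟩
  · have : ∀ j : ℕ, eLpNorm (fun x => (0 : L2 n) x - 0) 2 (volume.restrict U) = 0 := fun j => by
      rw [eLpNorm_congr_ae (g := 0), eLpNorm_zero]
      filter_upwards [ae_restrict_of_ae (Lp.coeFn_zero ℝ 2 volume)] with x hx
      simp
    exact tendsto_const_nhds.congr fun j => (this j).symm
  · have : ∀ j : ℕ, eLpNorm (fun x => weakGrad (0 : L2 n) x - gradient (fun _ => (0 : ℝ)) x) 2
        (volume.restrict U) = 0 := fun j => by
      rw [eLpNorm_congr_ae (g := 0), eLpNorm_zero]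
      rw [hw]
      filter_upwards [ae_restrict_of_ae (Lp.coeFn_zero (RSpace n) 2 volume)] with x hx
      simp [gradient_fun_const]
    exact tendsto_const_nhds.congr fun j => (this j).symm

/-- The space `X` as a linear subspace of `L²(ℝⁿ)`. -/
def submoduleX (Ω N : Set (RSpace n)) : Submodule ℝ (L2 n) where
  carrier := spaceX Ω N
  add_mem' := by
    rintro u v ⟨hu, hu', hu0⟩ ⟨hv, hv', hv0⟩
    refine ⟨⟨_, hu.isWeakGradient.add hv.isWeakGradient⟩, hu'.add hu hv hv', ?_⟩
    filter_upwards [hu0, hv0, Lp.coeFn_add u v] with x h1 h2 h3 hx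
    exact h3.trans (by simp [h1 hx, h2 hx])
  zero_mem' := by
    refine ⟨memH1_zero, restrictMemH10_zero, ?_⟩
    filter_upwards [Lp.coeFn_zero ℝ 2 volume] with x hx _
    simp
  smul_mem' := by
    rintro c u ⟨hu, hu', hu0⟩
    refine ⟨⟨_, hu.isWeakGradient.smul c⟩, hu'.smul c hu, ?_⟩
    filter_upwards [hu0, Lp.coeFn_smul c u] with x h1 h3 hx
    exact h3.trans (by simp [h1 hx])

end spaceX

/-! ### Translation estimates in `L²`. -/

section translation

variable {n : ℕ}

theorem eLpNorm_two_sq {α E : Type*} [MeasurableSpace α] [NormedAddCommGroup E] (μ : Measure α)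
    (f : α → E) : eLpNorm f 2 μ ^ 2 = ∫⁻ x, ‖f x‖ₑ ^ 2 ∂μ := by
  simpa using eLpNorm_nnreal_pow_eq_lintegral (p := 2) (f := f) (μ := μ) (by norm_num)

theorem ofReal_sq_eq (r : ℝ) : ENNReal.ofReal (r ^ 2) = ‖r‖ₑ ^ 2 := by
  rw [← sq_abs, ENNReal.ofReal_pow (abs_nonneg _), Real.enorm_eq_ofReal_abs]

/-- Expand the nonnegative variance of `d` about its mean `c`. -/
theorem sq_intervalIntegral_le {d : ℝ → ℝ} (hd : Continuous d) :
    (∫ t in (0 : ℝ)..1, d t) ^ 2 ≤ ∫ t in (0 : ℝ)..1, d t ^ 2 := by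
  set c := ∫ t in (0 : ℝ)..1, d t with hc
  have h0 : 0 ≤ ∫ t in (0 : ℝ)..1, (d t - c) ^ 2 :=
    intervalIntegral.integral_nonneg zero_le_one fun t _ => sq_nonneg _
  have h1 : ∫ t in (0 : ℝ)..1, (d t - c) ^ 2 = ∫ t in (0 : ℝ)..1, (d t ^ 2 - 2 * c * d t + c ^ 2) :=
    intervalIntegral.integral_congr fun t _ => by ring
  rw [h1, intervalIntegral.integral_add, intervalIntegral.integral_sub,
    intervalIntegral.integral_const_mul, ← hc] at h0
  · simp at h0
    nlinarith
  all_goals exact Continuous.intervalIntegrable (by fun_prop) _ _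

/-- The increment is the integral of the directional derivative along the segment from `x` to `x +
z`; then `sq_intervalIntegral_le` and Cauchy–Schwarz apply. -/
theorem enorm_translate_sub_sq_le {φ : RSpace n → ℝ} (hφ : ContDiff ℝ ∞ φ) (x z : RSpace n) :
    ‖φ (x + z) - φ x‖ₑ ^ 2
      ≤ ‖z‖ₑ ^ 2 * ∫⁻ t in Ioc (0 : ℝ) 1, ‖gradient φ (x + t • z)‖ₑ ^ 2 := by
  have hg := continuous_gradient hφ
  set d : ℝ → ℝ := fun t => inner ℝ (gradient φ (x + t • z)) z with hd
  have hdc : Continuous d := by fun_prop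
  have hderiv : ∀ t ∈ uIcc (0 : ℝ) 1, HasDerivAt (fun t : ℝ => φ (x + t • z)) (d t) t := by
    intro t _
    have h1 : HasDerivAt (fun t : ℝ => x + t • z) z t := by
      simpa using ((hasDerivAt_id t).smul_const z).const_add x
    have h2 := ((hφ.differentiable (by simp)) (x + t • z)).hasFDerivAt.comp_hasDerivAt t h1
    rwa [← inner_gradient_left] at h2
  have hint := intervalIntegral.integral_eq_sub_of_hasDerivAt hderiv
    (hdc.intervalIntegrable _ _)
  simp only [one_smul, zero_smul, add_zero] at hint
  have hsq := sq_intervalIntegral_le hdc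
  rw [hint, intervalIntegral.integral_of_le zero_le_one] at hsq
  have hle : ∀ t, ENNReal.ofReal (d t ^ 2) ≤ ‖z‖ₑ ^ 2 * ‖gradient φ (x + t • z)‖ₑ ^ 2 := by
    intro t
    rw [ofReal_sq_eq, ← mul_pow]
    gcongr
    rw [← ofReal_norm, ← ofReal_norm, ← ofReal_norm, ← ENNReal.ofReal_mul (norm_nonneg _),
      mul_comm]
    exact ENNReal.ofReal_le_ofReal (norm_inner_le_norm _ _)
  calc ‖φ (x + z) - φ x‖ₑ ^ 2 = ENNReal.ofReal ((φ (x + z) - φ x) ^ 2) := by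
        rw [ofReal_sq_eq]
    _ ≤ ENNReal.ofReal (∫ t in Ioc (0 : ℝ) 1, d t ^ 2) := ENNReal.ofReal_le_ofReal hsq
    _ = ∫⁻ t in Ioc (0 : ℝ) 1, ENNReal.ofReal (d t ^ 2) :=
        ofReal_integral_eq_lintegral_ofReal
          ((hdc.pow 2).integrableOn_Icc.mono_set Ioc_subset_Icc_self)
          (Eventually.of_forall fun t => sq_nonneg _)
    _ ≤ ∫⁻ t in Ioc (0 : ℝ) 1, ‖z‖ₑ ^ 2 * ‖gradient φ (x + t • z)‖ₑ ^ 2 :=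
        lintegral_mono hle
    _ = _ := lintegral_const_mul' _ _ (by simp)

theorem eLpNorm_translate_sub_le {φ : RSpace n → ℝ} (hφ : ContDiff ℝ ∞ φ) (z : RSpace n) :
    eLpNorm (fun x => φ (x + z) - φ x) 2 volume ≤ ‖z‖ₑ * eLpNorm (gradient φ) 2 volume := by
  have hg := continuous_gradient hφ
  rw [← ENNReal.pow_le_pow_left_iff two_ne_zero, mul_pow, eLpNorm_two_sq, eLpNorm_two_sq]
  calc ∫⁻ x, ‖φ (x + z) - φ x‖ₑ ^ 2
      ≤ ∫⁻ x, ‖z‖ₑ ^ 2 * ∫⁻ t in Ioc (0 : ℝ) 1, ‖gradient φ (x + t • z)‖ₑ ^ 2 :=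
        lintegral_mono fun x => enorm_translate_sub_sq_le hφ x z
    _ = ‖z‖ₑ ^ 2 * ∫⁻ x, ∫⁻ t in Ioc (0 : ℝ) 1, ‖gradient φ (x + t • z)‖ₑ ^ 2 :=
        lintegral_const_mul' _ _ (by simp)
    _ = ‖z‖ₑ ^ 2 * ∫⁻ t in Ioc (0 : ℝ) 1, ∫⁻ x, ‖gradient φ (x + t • z)‖ₑ ^ 2 := by
        rw [lintegral_lintegral_swap]
        exact ((hg.comp (by fun_prop :
          Continuous fun p : RSpace n × ℝ => p.1 + p.2 • z)).enorm.measurable.pow_const 2).aemeasurable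
    _ = ‖z‖ₑ ^ 2 * ∫⁻ x, ‖gradient φ x‖ₑ ^ 2 := by
        congr 1
        simp only [lintegral_add_right_eq_self (fun x => ‖gradient φ x‖ₑ ^ 2)]
        simp

theorem eLpNorm_comp_add_right {E : Type*} [NormedAddCommGroup E] {f : RSpace n → E}
    (hf : AEStronglyMeasurable f volume) (z : RSpace n) :
    eLpNorm (fun x => f (x + z)) 2 volume = eLpNorm f 2 volume :=
  eLpNorm_comp_measurePreserving hf (measurePreserving_add_right volume z)

theorem measurableSet_mixedU {Ω N : Set (RSpace n)} (hΩ : IsOpen Ω) (hN : IsOpen N) :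
    MeasurableSet (mixedU Ω N) :=
  (hΩ.measurableSet.union hN.measurableSet).union
    (isClosed_frontier.measurableSet.inter isClosed_closure.measurableSet)

theorem eLpNorm_eq_restrict {E : Type*} [NormedAddCommGroup E] {U : Set (RSpace n)}
    (hU : MeasurableSet U) {f : RSpace n → E} (hf : ∀ᵐ x, x ∉ U → f x = 0) :
    eLpNorm f 2 volume = eLpNorm f 2 (volume.restrict U) := by
  rw [← eLpNorm_indicator_eq_eLpNorm_restrict hU]
  refine eLpNorm_congr_ae ?_
  filter_upwards [hf] with x hx
  by_cases h : x ∈ U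
  · simp [h]
  · simp [h, hx h]

/-- Translations of `u ∈ X` are Lipschitz in `L²`. -/
theorem exists_eLpNorm_translate_sub_le {Ω N : Set (RSpace n)} (hΩ : IsOpen Ω) (hN : IsOpen N)
    {u : L2 n} (hu : u ∈ spaceX Ω N) :
    ∃ K : ℝ≥0∞, K ≠ ⊤ ∧ ∀ z, eLpNorm (fun x => u (x + z) - u x) 2 volume ≤ ‖z‖ₑ * K := by
  obtain ⟨-, ⟨φ, hφ, h1, h2⟩, h0⟩ := hu
  have hU := measurableSet_mixedU hΩ hN
  have hum := Lp.aestronglyMeasurable u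
  have hcont : ∀ j, AEStronglyMeasurable (φ j) volume := fun j =>
    (hφ j).1.continuous.aestronglyMeasurable
  -- Convergence is only given on `U`, but `u` and `φ j` both vanish outside `U`.
  have h1' : Tendsto (fun j => eLpNorm (fun x => u x - φ j x) 2 volume) atTop (𝓝 0) := by
    refine h1.congr fun j => (eLpNorm_eq_restrict hU ?_).symm
    filter_upwards [h0] with x hx hxU
    rw [hx hxU, image_eq_zero_of_notMem_tsupport fun h => hxU ((hφ j).2.2 h), sub_zero]
  -- The gradient of `φ j` lives in `U`, so only the comparison with `weakGrad u` on `U` is needed.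
  have hG : ∀ j, eLpNorm (gradient (φ j)) 2 volume
      ≤ eLpNorm (weakGrad u) 2 volume
        + eLpNorm (fun x => weakGrad u x - gradient (φ j) x) 2 (volume.restrict (mixedU Ω N)) := by
    intro j
    have hm := (continuous_gradient (hφ j).1).aestronglyMeasurable (μ := volume)
    rw [eLpNorm_eq_restrict hU (f := gradient (φ j)) (Eventually.of_forall fun x hx =>
      gradient_eq_zero_of_notMem_tsupport fun h => hx ((hφ j).2.2 h))]
    have := eLpNorm_sub_le (p := 2) (μ := volume.restrict (mixedU Ω N))
      (Lp.aestronglyMeasurable (weakGrad u)).restrict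
      ((Lp.aestronglyMeasurable (weakGrad u)).restrict.sub hm.restrict) (by norm_num)
    refine (le_of_eq ?_).trans (this.trans (add_le_add (eLpNorm_restrict_le _ _ _ _) le_rfl))
    congr 1
    funext x
    simp
  refine ⟨eLpNorm (weakGrad u) 2 volume, (Lp.eLpNorm_ne_top _), fun z => ?_⟩
  have hbound : ∀ j, eLpNorm (fun x => u (x + z) - u x) 2 volume
      ≤ eLpNorm (fun x => u x - φ j x) 2 volume
        + ‖z‖ₑ * (eLpNorm (weakGrad u) 2 volume
          + eLpNorm (fun x => weakGrad u x - gradient (φ j) x) 2 (volume.restrict (mixedU Ω N)))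
        + eLpNorm (fun x => u x - φ j x) 2 volume := by
    intro j
    have hsplit : (fun x => u (x + z) - u x)
        = ((fun x => u (x + z) - φ j (x + z)) + fun x => φ j (x + z) - φ j x)
          - fun x => u x - φ j x := by
      funext x
      simp only [Pi.add_apply, Pi.sub_apply]
      ring
    have hA : AEStronglyMeasurable (fun x => u x - φ j x) volume := hum.sub (hcont j)
    have hB : AEStronglyMeasurable (fun x => u (x + z) - φ j (x + z)) volume :=
      hA.comp_measurePreserving (measurePreserving_add_right volume z)
    have hC : AEStronglyMeasurable (fun x => φ j (x + z) - φ j x) volume :=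
      ((hcont j).comp_measurePreserving (measurePreserving_add_right volume z)).sub (hcont j)
    rw [hsplit]
    refine (eLpNorm_sub_le (hB.add hC) hA (by norm_num)).trans (add_le_add ?_ le_rfl)
    refine (eLpNorm_add_le hB hC (by norm_num)).trans (add_le_add ?_ ?_)
    · exact (eLpNorm_comp_add_right hA z).le
    · exact (eLpNorm_translate_sub_le (hφ j).1 z).trans (by gcongr; exact hG j)
  refine ge_of_tendsto' (x := atTop) ?_ hbound
  have := (h1'.add (ENNReal.Tendsto.const_mul ((tendsto_const_nhds
    (x := eLpNorm (weakGrad u) 2 volume)).add h2)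
    (Or.inr (enorm_ne_top (x := z))))).add h1'
  simpa using this

end translation

/-! ### The singular kernel: integrability and a Poincaré inequality on small balls. -/

section kernel

variable {n : ℕ} {s : ℝ}

/-- In polar coordinates the radial density is `r^(1-2s)` on `(0, 1]`, integrable as `s < 1`, and
`r^(-1-2s)` beyond, integrable as `s > 0`. -/
theorem integrable_min_sq_div_norm_rpow (hn : 1 ≤ n) (hs0 : 0 < s) (hs1 : s < 1) :
    Integrable (fun z : RSpace n => min (‖z‖ ^ 2) 1 / ‖z‖ ^ ((n : ℝ) + 2 * s)) := by
  have : Nonempty (Fin n) := ⟨⟨0, hn⟩⟩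
  rw [integrable_fun_norm_addHaar (volume : Measure (RSpace n))
    (f := fun r : ℝ => min (r ^ 2) 1 / r ^ ((n : ℝ) + 2 * s))]
  have hpow : ∀ r : ℝ, 0 < r → r ^ (n - 1) / r ^ ((n : ℝ) + 2 * s) = r ^ (-1 - 2 * s) := by
    intro r hr
    rw [← Real.rpow_natCast, Nat.cast_sub hn, ← Real.rpow_sub hr]
    congr 1
    push_cast
    ring
  rw [← Ioc_union_Ioi_eq_Ioi (zero_le_one (α := ℝ))]
  refine IntegrableOn.union ?_ ?_
  · have h1 : IntegrableOn (fun r : ℝ => r ^ (1 - 2 * s)) (Ioc 0 1) := by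
      have := intervalIntegral.intervalIntegrable_rpow' (r := 1 - 2 * s) (by linarith)
        (a := 0) (b := 1)
      rwa [intervalIntegrable_iff_integrableOn_Ioc_of_le zero_le_one] at this
    refine h1.congr_fun (fun r hr => ?_) measurableSet_Ioc
    have hr0 : 0 < r := hr.1
    simp only [finrank_euclideanSpace, Fintype.card_fin, smul_eq_mul]
    rw [min_eq_left (pow_le_one₀ hr0.le hr.2), mul_div_left_comm, hpow r hr0,
      ← Real.rpow_natCast, ← Real.rpow_add hr0]
    congr 1
    push_cast
    ring
  · refine (integrableOn_Ioi_rpow_of_lt (a := -1 - 2 * s) (by linarith) zero_lt_one).congr_fun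
      (fun r hr => ?_) measurableSet_Ioi
    have hr1 : 1 < r := hr
    simp only [finrank_euclideanSpace, Fintype.card_fin, smul_eq_mul]
    rw [min_eq_right (one_le_pow₀ hr1.le), mul_one_div, hpow r (by linarith)]

/-- The integrand of the nonlocal part of the energy. -/
noncomputable def nonlocalIntegrand (s : ℝ) (u v : RSpace n → ℝ) (p : RSpace n × RSpace n) : ℝ :=
  (u p.1 - u p.2) * (v p.1 - v p.2) / ‖p.1 - p.2‖ ^ ((n : ℝ) + 2 * s)

theorem measurable_nonlocalIntegrand {u v : RSpace n → ℝ} (hu : Measurable u)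
    (hv : Measurable v) : Measurable (nonlocalIntegrand s u v) := by
  unfold nonlocalIntegrand
  fun_prop

theorem nonlocalIntegrand_self_nonneg (u : RSpace n → ℝ) (p : RSpace n × RSpace n) :
    0 ≤ nonlocalIntegrand s u u p :=
  div_nonneg (mul_self_nonneg _) (Real.rpow_nonneg (norm_nonneg _) _)

/-- Substitute `y = x + z` and integrate in `x` first: the translation bound tames small `z`, the
triangle inequality handles large `z`. -/
theorem integrable_nonlocalIntegrand_self (hn : 1 ≤ n) (hs0 : 0 < s) (hs1 : s < 1)
    {u : RSpace n → ℝ} (hu : Measurable u) (hu2 : MemLp u 2 volume) {K : ℝ≥0∞} (hK : K ≠ ⊤)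
    (h : ∀ z, eLpNorm (fun x => u (x + z) - u x) 2 volume ≤ ‖z‖ₑ * K) :
    Integrable (nonlocalIntegrand s u u) := by
  have hmeas := measurable_nonlocalIntegrand (s := s) hu hu
  refine ⟨hmeas.aestronglyMeasurable, ?_⟩
  rw [hasFiniteIntegral_iff_ofReal (Eventually.of_forall (nonlocalIntegrand_self_nonneg u))]
  -- One constant for both regimes: `K ^ 2` serves `‖z‖ ≤ 1` and `(2 * ‖u‖) ^ 2` serves `‖z‖ ≥ 1`.
  set M : ℝ≥0∞ := (2 * eLpNorm u 2 volume + K) ^ 2 with hM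
  have hMtop : M ≠ ⊤ := by
    have := hu2.eLpNorm_ne_top
    finiteness
  have hbd : ∀ z, ∫⁻ x, ENNReal.ofReal ((u (x + z) - u x) ^ 2)
      ≤ M * ENNReal.ofReal (min (‖z‖ ^ 2) 1) := by
    intro z
    simp only [ofReal_sq_eq]
    rw [← eLpNorm_two_sq volume (fun x => u (x + z) - u x)]
    rcases le_total (‖z‖ ^ 2) 1 with hz | hz
    · rw [min_eq_left hz, ENNReal.ofReal_pow (norm_nonneg _), ofReal_norm, hM, ← mul_pow, mul_comm]
      gcongr
      exact (h z).trans (by gcongr; exact le_add_self)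
    · rw [min_eq_right hz, ENNReal.ofReal_one, mul_one, hM]
      gcongr
      refine (eLpNorm_sub_le (f := fun x => u (x + z))
        (hu2.1.comp_measurePreserving (measurePreserving_add_right volume z)) hu2.1
        (by norm_num)).trans ?_
      rw [eLpNorm_comp_add_right hu2.1, ← two_mul]
      exact le_self_add
  have hint := (integrable_min_sq_div_norm_rpow hn hs0 hs1).lintegral_lt_top
  calc ∫⁻ p, ENNReal.ofReal (nonlocalIntegrand s u u p)
      = ∫⁻ x, ∫⁻ y, ENNReal.ofReal (nonlocalIntegrand s u u (x, y)) := by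
        rw [Measure.volume_eq_prod, lintegral_prod _ hmeas.ennreal_ofReal.aemeasurable]
    _ = ∫⁻ x, ∫⁻ z, ENNReal.ofReal (nonlocalIntegrand s u u (x, x + z)) :=
        lintegral_congr fun x => (lintegral_add_left_eq_self
          (fun y => ENNReal.ofReal (nonlocalIntegrand s u u (x, y))) x).symm
    _ = ∫⁻ z, ∫⁻ x, ENNReal.ofReal (nonlocalIntegrand s u u (x, x + z)) := by
        rw [lintegral_lintegral_swap]
        exact (hmeas.comp (by fun_prop :
          Measurable fun p : RSpace n × RSpace n => (p.1, p.1 + p.2))).ennreal_ofReal.aemeasurable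
    _ = ∫⁻ z, ENNReal.ofReal (1 / ‖z‖ ^ ((n : ℝ) + 2 * s))
          * ∫⁻ x, ENNReal.ofReal ((u (x + z) - u x) ^ 2) := by
        refine lintegral_congr fun z => ?_
        rw [← lintegral_const_mul' _ _ ENNReal.ofReal_ne_top]
        refine lintegral_congr fun x => ?_
        rw [← ENNReal.ofReal_mul (by positivity), nonlocalIntegrand]
        congr 1
        simp only [sub_add_cancel_left, norm_neg]
        ring
    _ ≤ ∫⁻ z, ENNReal.ofReal (1 / ‖z‖ ^ ((n : ℝ) + 2 * s))
          * (M * ENNReal.ofReal (min (‖z‖ ^ 2) 1)) := by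
        gcongr with z
        exact hbd z
    _ = ∫⁻ z : RSpace n, M * ENNReal.ofReal (min (‖z‖ ^ 2) 1 / ‖z‖ ^ ((n : ℝ) + 2 * s)) := by
        refine lintegral_congr fun z => ?_
        rw [mul_left_comm, ← ENNReal.ofReal_mul (by positivity), one_div_mul_eq_div]
    _ = M * ∫⁻ z : RSpace n, ENNReal.ofReal (min (‖z‖ ^ 2) 1 / ‖z‖ ^ ((n : ℝ) + 2 * s)) :=
        lintegral_const_mul' _ _ hMtop
    _ < ⊤ := ENNReal.mul_lt_top hMtop.lt_top hint

theorem integrable_nonlocalIntegrand {u v : RSpace n → ℝ} (hu : Measurable u)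
    (hv : Measurable v) (hu2 : Integrable (nonlocalIntegrand s u u))
    (hv2 : Integrable (nonlocalIntegrand s v v)) : Integrable (nonlocalIntegrand s u v) := by
  refine (hu2.add hv2).mono' (measurable_nonlocalIntegrand hu hv).aestronglyMeasurable
    (Eventually.of_forall fun p => ?_)
  have hd : 0 ≤ ‖p.1 - p.2‖ ^ ((n : ℝ) + 2 * s) := Real.rpow_nonneg (norm_nonneg _) _
  simp only [nonlocalIntegrand, Pi.add_apply, Real.norm_eq_abs]
  rw [abs_div, abs_of_nonneg hd, ← add_div]
  refine div_le_div_of_nonneg_right ?_ hd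
  rw [abs_mul, ← abs_mul_abs_self (u p.1 - u p.2), ← abs_mul_abs_self (v p.1 - v p.2)]
  nlinarith [sq_nonneg (|u p.1 - u p.2| - |v p.1 - v p.2|), abs_nonneg (u p.1 - u p.2),
    abs_nonneg (v p.1 - v p.2), mul_nonneg (abs_nonneg (u p.1 - u p.2)) (abs_nonneg (v p.1 - v p.2))]

/-- A Poincaré inequality: a function with vanishing mean on a ball is controlled pointwise by
its nonlocal energy density. -/
theorem sq_le_of_setIntegral_ball_eq_zero (hs0 : 0 < s) {u : RSpace n → ℝ}
    (hu : MemLp u 2 volume) {c x : RSpace n} {r : ℝ} (hx : x ∈ Metric.ball c r)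
    (hmean : ∫ y in Metric.ball c r, u y = 0)
    (hint : Integrable fun y => nonlocalIntegrand s u u (x, y)) :
    volume.real (Metric.ball c r) * u x ^ 2
      ≤ (2 * r) ^ ((n : ℝ) + 2 * s) * ∫ y, nonlocalIntegrand s u u (x, y) := by
  set B := Metric.ball c r with hB
  have hr : 0 < r := Metric.pos_of_mem_ball hx
  have : IsFiniteMeasure (volume.restrict B) := ⟨by simpa using measure_ball_lt_top⟩
  have huB : MemLp u 2 (volume.restrict B) := hu.restrict B
  have hu1 : Integrable u (volume.restrict B) := huB.integrable (by norm_num)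
  have hu2 : Integrable (fun y => u y ^ 2) (volume.restrict B) := huB.integrable_sq
  -- The cross term drops out because the mean of `u` on `B` is zero.
  have hexp : ∫ y in B, (u x - u y) ^ 2 = volume.real B * u x ^ 2 + ∫ y in B, u y ^ 2 := by
    have h1 : ∀ y, (u x - u y) ^ 2 = (u x ^ 2 - 2 * u x * u y) + u y ^ 2 := fun y => by ring
    simp only [h1]
    have h2 : Integrable (fun y => u x ^ 2 - 2 * u x * u y) (volume.restrict B) :=
      (integrable_const _).sub (hu1.const_mul _)
    rw [integral_add h2 hu2, integral_sub (integrable_const _) (hu1.const_mul _), integral_const_mul, hmean]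
    simp
  have hpt : ∀ y ∈ B, (u x - u y) ^ 2
      ≤ (2 * r) ^ ((n : ℝ) + 2 * s) * nonlocalIntegrand s u u (x, y) := by
    intro y hy
    rcases eq_or_ne x y with rfl | hxy
    · simp [nonlocalIntegrand]
    have hpos : 0 < ‖x - y‖ := norm_pos_iff.2 (sub_ne_zero.2 hxy)
    have hlt : ‖x - y‖ ≤ 2 * r := by
      rw [← dist_eq_norm]
      have h1 := Metric.mem_ball.1 hx
      have h2 := Metric.mem_ball'.1 hy
      linarith [dist_triangle x c y]
    have hle : ‖x - y‖ ^ ((n : ℝ) + 2 * s) ≤ (2 * r) ^ ((n : ℝ) + 2 * s) :=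
      Real.rpow_le_rpow hpos.le hlt (by positivity)
    have hpp : 0 < ‖x - y‖ ^ ((n : ℝ) + 2 * s) := Real.rpow_pos_of_pos hpos _
    simp only [nonlocalIntegrand]
    rw [mul_div_assoc', le_div_iff₀ hpp, mul_comm, ← sq]
    exact mul_le_mul_of_nonneg_right hle (sq_nonneg _)
  have h2 : (0 : ℝ) ≤ ∫ y in B, u y ^ 2 := integral_nonneg fun y => sq_nonneg _
  calc volume.real B * u x ^ 2 ≤ ∫ y in B, (u x - u y) ^ 2 := by linarith
    _ ≤ ∫ y in B, (2 * r) ^ ((n : ℝ) + 2 * s) * nonlocalIntegrand s u u (x, y) :=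
        setIntegral_mono_on (((memLp_const (u x)).sub huB).integrable_sq)
          (hint.integrableOn.const_mul _) measurableSet_ball hpt
    _ ≤ ∫ y, (2 * r) ^ ((n : ℝ) + 2 * s) * nonlocalIntegrand s u u (x, y) :=
        setIntegral_le_integral (hint.const_mul _) (Eventually.of_forall fun y =>
          mul_nonneg (by positivity) (nonlocalIntegrand_self_nonneg u _))
    _ = _ := integral_const_mul _ _

/-- Each `x ∈ Ω` uses a single ball containing it, and its density is integrated over all `y`, so
overlaps of the balls cost nothing. -/
theorem setIntegral_sq_le_of_setIntegral_ball_eq_zero (hs0 : 0 < s) {Ω : Set (RSpace n)}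
    (hΩ : MeasurableSet Ω) {u : RSpace n → ℝ} (hu : MemLp u 2 volume)
    (hint : Integrable (nonlocalIntegrand s u u)) {t : Set (RSpace n)} {r : ℝ}
    (hr : 0 < r) (hcover : Ω ⊆ ⋃ c ∈ t, Metric.ball c r)
    (hmean : ∀ c ∈ t, ∫ y in Metric.ball c r, u y = 0) :
    ∫ x in Ω, u x ^ 2 ≤ (2 * r) ^ ((n : ℝ) + 2 * s) / volume.real (Metric.ball (0 : RSpace n) r)
      * ∫ p in setQ Ω, nonlocalIntegrand s u u p := by
  have hvol : 0 < volume.real (Metric.ball (0 : RSpace n) r) :=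
    ENNReal.toReal_pos (Metric.measure_ball_pos _ _ hr).ne' measure_ball_lt_top.ne
  have hint' : Integrable (nonlocalIntegrand s u u)
      ((volume : Measure (RSpace n)).prod volume) := hint
  have hsub : Ω ×ˢ (univ : Set (RSpace n)) ⊆ setQ Ω := fun p hp hq => hq.1 hp.1
  have hQ : ∫ x in Ω, ∫ y, nonlocalIntegrand s u u (x, y)
      ≤ ∫ p in setQ Ω, nonlocalIntegrand s u u p := by
    have h1 := setIntegral_prod (s := Ω) (t := univ) (nonlocalIntegrand s u u)
      hint'.integrableOn
    rw [Measure.restrict_univ] at h1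
    rw [← h1]
    exact setIntegral_mono_set hint.integrableOn
      (Eventually.of_forall (nonlocalIntegrand_self_nonneg u)) hsub.eventuallyLE
  rw [div_mul_eq_mul_div, le_div_iff₀ hvol, mul_comm]
  calc volume.real (Metric.ball (0 : RSpace n) r) * ∫ x in Ω, u x ^ 2
      = ∫ x in Ω, volume.real (Metric.ball (0 : RSpace n) r) * u x ^ 2 :=
        (integral_const_mul _ _).symm
    _ ≤ ∫ x in Ω, (2 * r) ^ ((n : ℝ) + 2 * s) * ∫ y, nonlocalIntegrand s u u (x, y) := by
        refine integral_mono_ae ((hu.restrict Ω).integrable_sq.const_mul _)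
          (hint'.integral_prod_left.integrableOn.const_mul _) ?_
        filter_upwards [ae_restrict_of_ae hint'.prod_right_ae, ae_restrict_mem hΩ] with x hx hxΩ
        obtain ⟨c, hc, hxc⟩ := mem_iUnion₂.1 (hcover hxΩ)
        have := sq_le_of_setIntegral_ball_eq_zero hs0 hu hxc (hmean c hc) hx
        rwa [measureReal_def, Measure.addHaar_ball_center, ← measureReal_def] at this
    _ = (2 * r) ^ ((n : ℝ) + 2 * s) * ∫ x in Ω, ∫ y, nonlocalIntegrand s u u (x, y) :=
        integral_const_mul _ _
    _ ≤ _ := by gcongr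

theorem exists_radius_le (hs0 : 0 < s) {ε : ℝ} (hε : 0 < ε) :
    ∃ r : ℝ, 0 < r ∧
      (2 * r) ^ ((n : ℝ) + 2 * s) / volume.real (Metric.ball (0 : RSpace n) r) ≤ ε := by
  set V := volume.real (Metric.ball (0 : RSpace n) 1) with hV
  have hVpos : 0 < V :=
    ENNReal.toReal_pos (Metric.measure_ball_pos _ _ one_pos).ne' measure_ball_lt_top.ne
  set C := (2 : ℝ) ^ ((n : ℝ) + 2 * s) / V with hC
  have hCpos : 0 < C := by positivity
  -- The quotient equals `C * r ^ (2 * s)`; this radius makes it exactly `ε`.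
  refine ⟨(ε / C) ^ (1 / (2 * s)), by positivity, le_of_eq ?_⟩
  set r := (ε / C) ^ (1 / (2 * s)) with hr
  have hrpos : 0 < r := by positivity
  have h1 : volume.real (Metric.ball (0 : RSpace n) r) = r ^ n * V := by
    rw [measureReal_def, Measure.addHaar_ball_of_pos _ _ hrpos, ENNReal.toReal_mul,
      ENNReal.toReal_ofReal (by positivity), finrank_euclideanSpace, Fintype.card_fin, hV,
      measureReal_def]
  have h2 : r ^ (2 * s) = ε / C := by
    rw [hr, ← Real.rpow_mul (by positivity), one_div_mul_cancel (by positivity), Real.rpow_one]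
  rw [h1, Real.mul_rpow two_pos.le hrpos.le, Real.rpow_add hrpos, h2, Real.rpow_natCast]
  have h3 : r ^ n ≠ 0 := by positivity
  have h4 : (2 : ℝ) ^ ((n : ℝ) + 2 * s) = C * V := by rw [hC]; field_simp
  rw [h4]
  field_simp

end kernel

/-! ### Energy and mass as bilinear forms on `X`. -/

section forms

variable {n : ℕ} {s : ℝ} {Ω N : Set (RSpace n)}

theorem energy_eq (u v : L2 n) : energy s Ω u v
    = (∫ x in Ω, inner ℝ (weakGrad u x) (weakGrad v x)) + ∫ p in setQ Ω, nonlocalIntegrand s u v p :=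
  rfl

theorem ae_prod_of_ae {P : RSpace n → Prop} (h : ∀ᵐ x, P x) :
    ∀ᵐ p : RSpace n × RSpace n, P p.1 ∧ P p.2 :=
  (Measure.quasiMeasurePreserving_fst.ae h).and (Measure.quasiMeasurePreserving_snd.ae h)

theorem measurable_L2 (u : L2 n) : Measurable u := (Lp.stronglyMeasurable u).measurable

theorem integrable_L2_mul (u v : L2 n) : Integrable fun x => u x * v x :=
  (Lp.memLp u).integrable_mul (Lp.memLp v)

/-- Finiteness of the nonlocal part of the energy on `X`. -/
theorem integrable_nonlocalIntegrand_of_mem_spaceX (hn : 1 ≤ n) (hs0 : 0 < s) (hs1 : s < 1)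
    (hΩ : IsOpen Ω) (hN : IsOpen N) {u v : L2 n} (hu : u ∈ spaceX Ω N) (hv : v ∈ spaceX Ω N) :
    Integrable (nonlocalIntegrand s u v) := by
  have key : ∀ w : L2 n, w ∈ spaceX Ω N → Integrable (nonlocalIntegrand s w w) := fun w hw => by
    obtain ⟨K, hK, h⟩ := exists_eLpNorm_translate_sub_le hΩ hN hw
    exact integrable_nonlocalIntegrand_self hn hs0 hs1 (measurable_L2 w) (Lp.memLp w) hK h
  exact integrable_nonlocalIntegrand (measurable_L2 u) (measurable_L2 v) (key u hu) (key v hv)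

theorem energy_comm (u v : L2 n) : energy s Ω u v = energy s Ω v u := by
  rw [energy_eq, energy_eq]
  congr 1
  · exact integral_congr_ae (Eventually.of_forall fun x => real_inner_comm _ _)
  · exact integral_congr_ae (Eventually.of_forall fun p => by
      simp only [nonlocalIntegrand, mul_comm])

theorem energy_add_left (hn : 1 ≤ n) (hs0 : 0 < s) (hs1 : s < 1)
    (hΩ : IsOpen Ω) (hN : IsOpen N) {u v w : L2 n} (hu : u ∈ spaceX Ω N) (hv : v ∈ spaceX Ω N)
    (hw : w ∈ spaceX Ω N) : energy s Ω (u + v) w = energy s Ω u w + energy s Ω v w := by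
  have hI := fun {u v : L2 n} (hu : u ∈ spaceX Ω N) (hv : v ∈ spaceX Ω N) =>
    integrable_nonlocalIntegrand_of_mem_spaceX hn hs0 hs1 hΩ hN hu hv
  have h1 : ∫ x in Ω, inner ℝ (weakGrad (u + v) x) (weakGrad w x)
      = (∫ x in Ω, inner ℝ (weakGrad u x) (weakGrad w x))
        + ∫ x in Ω, inner ℝ (weakGrad v x) (weakGrad w x) := by
    rw [← integral_add (L2.integrable_inner _ _).restrict
      (L2.integrable_inner _ _).restrict]
    refine integral_congr_ae (ae_restrict_of_ae ?_)
    rw [hu.1.weakGrad_add hv.1]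
    filter_upwards [Lp.coeFn_add (weakGrad u) (weakGrad v)] with x hx
    rw [hx, Pi.add_apply, inner_add_left]
  have h2 : ∫ p in setQ Ω, nonlocalIntegrand s (u + v : L2 n) w p
      = (∫ p in setQ Ω, nonlocalIntegrand s u w p)
        + ∫ p in setQ Ω, nonlocalIntegrand s v w p := by
    rw [← integral_add (hI hu hw).integrableOn (hI hv hw).integrableOn]
    refine integral_congr_ae (ae_restrict_of_ae ?_)
    filter_upwards [ae_prod_of_ae (Lp.coeFn_add u v)] with p hp
    simp only [nonlocalIntegrand, hp.1, hp.2, Pi.add_apply]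
    ring
  rw [energy_eq, energy_eq, energy_eq, h1, h2]
  ring

/-- Unlike additivity, homogeneity of the integral needs no integrability, so membership in `X` is
not required. -/
theorem energy_smul_left (c : ℝ) {u : L2 n} (hu : MemH1 u) (w : L2 n) :
    energy s Ω (c • u) w = c * energy s Ω u w := by
  have h1 : ∫ x in Ω, inner ℝ (weakGrad (c • u) x) (weakGrad w x)
      = c * ∫ x in Ω, inner ℝ (weakGrad u x) (weakGrad w x) := by
    rw [← integral_const_mul]
    refine integral_congr_ae (ae_restrict_of_ae ?_)
    rw [hu.weakGrad_smul c]
    filter_upwards [Lp.coeFn_smul c (weakGrad u)] with x hx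
    rw [hx, Pi.smul_apply, real_inner_smul_left]
  have h2 : ∫ p in setQ Ω, nonlocalIntegrand s (c • u : L2 n) w p
      = c * ∫ p in setQ Ω, nonlocalIntegrand s u w p := by
    rw [← integral_const_mul]
    refine integral_congr_ae (ae_restrict_of_ae ?_)
    filter_upwards [ae_prod_of_ae (Lp.coeFn_smul c u)] with p hp
    simp only [nonlocalIntegrand, hp.1, hp.2, Pi.smul_apply, smul_eq_mul]
    ring
  rw [energy_eq, energy_eq, h1, h2]
  ring

/-- The energy as a bilinear form on `X`. -/
noncomputable def energyForm (hn : 1 ≤ n) (hs0 : 0 < s) (hs1 : s < 1) (hΩ : IsOpen Ω)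
    (hN : IsOpen N) : LinearMap.BilinForm ℝ (submoduleX Ω N) :=
  LinearMap.mk₂ ℝ (fun u v => energy s Ω u v)
    (fun u v w => energy_add_left hn hs0 hs1 hΩ hN u.2 v.2 w.2)
    (fun c u w => energy_smul_left c u.2.1 w)
    (fun u v w => by
      rw [energy_comm, energy_comm _ (v : L2 n), energy_comm _ (w : L2 n)]
      exact energy_add_left hn hs0 hs1 hΩ hN v.2 w.2 u.2)
    (fun c u w => by
      rw [energy_comm, energy_comm _ (w : L2 n)]
      exact energy_smul_left c w.2.1 u)

/-- The bilinear form `∫_Ω u v` on `X`. -/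
noncomputable def massForm (Ω N : Set (RSpace n)) : LinearMap.BilinForm ℝ (submoduleX Ω N) :=
  LinearMap.mk₂ ℝ (fun u v => ∫ x in Ω, (u : L2 n) x * (v : L2 n) x)
    (fun u v w => by
      rw [← integral_add (integrable_L2_mul _ _).restrict (integrable_L2_mul _ _).restrict]
      refine integral_congr_ae (ae_restrict_of_ae ?_)
      filter_upwards [Lp.coeFn_add (u : L2 n) v] with x hx
      rw [Submodule.coe_add, hx, Pi.add_apply, add_mul])
    (fun c u w => by
      rw [smul_eq_mul, ← integral_const_mul]
      refine integral_congr_ae (ae_restrict_of_ae ?_)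
      filter_upwards [Lp.coeFn_smul c (u : L2 n)] with x hx
      rw [Submodule.coe_smul, hx, Pi.smul_apply, smul_eq_mul, mul_assoc])
    (fun u v w => by
      rw [← integral_add (integrable_L2_mul _ _).restrict (integrable_L2_mul _ _).restrict]
      refine integral_congr_ae (ae_restrict_of_ae ?_)
      filter_upwards [Lp.coeFn_add (v : L2 n) w] with x hx
      rw [Submodule.coe_add, hx, Pi.add_apply, mul_add])
    (fun c u w => by
      rw [smul_eq_mul, ← integral_const_mul]
      refine integral_congr_ae (ae_restrict_of_ae ?_)
      filter_upwards [Lp.coeFn_smul c (w : L2 n)] with x hx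
      rw [Submodule.coe_smul, hx, Pi.smul_apply, smul_eq_mul, mul_left_comm])

theorem massForm_self (u : submoduleX Ω N) :
    massForm Ω N u u = ∫ x in Ω, ((u : L2 n) x) ^ 2 := by
  simp only [massForm, LinearMap.mk₂_apply, sq]

theorem massForm_self_nonneg (u : submoduleX Ω N) : 0 ≤ massForm Ω N u u := by
  rw [massForm_self]
  exact integral_nonneg fun x => sq_nonneg _

theorem massForm_comm (u v : submoduleX Ω N) : massForm Ω N u v = massForm Ω N v u := by
  simp only [massForm, LinearMap.mk₂_apply, mul_comm]

theorem nonlocal_le_energy (u : L2 n) :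
    ∫ p in setQ Ω, nonlocalIntegrand s u u p ≤ energy s Ω u u := by
  rw [energy_eq]
  exact le_add_of_nonneg_left (integral_nonneg fun x => real_inner_self_nonneg)

theorem nonlocal_self_nonneg (u : L2 n) : 0 ≤ ∫ p in setQ Ω, nonlocalIntegrand s u u p :=
  integral_nonneg fun p => nonlocalIntegrand_self_nonneg _ p

theorem energy_self_nonneg (u : L2 n) : 0 ≤ energy s Ω u u :=
  (nonlocal_self_nonneg u).trans (nonlocal_le_energy u)

/-- A function of zero energy is constant, hence zero since it is square integrable. -/
theorem eq_zero_of_energy_self_eq_zero (hn : 1 ≤ n) (hs0 : 0 < s) (hs1 : s < 1)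
    (hΩ : IsOpen Ω) (hne : Ω.Nonempty) (hN : IsOpen N) {u : L2 n} (hu : u ∈ spaceX Ω N)
    (h0 : energy s Ω u u = 0) : u = 0 := by
  have hint := integrable_nonlocalIntegrand_of_mem_spaceX hn hs0 hs1 hΩ hN hu hu
  have hQ : ∫ p in setQ Ω, nonlocalIntegrand s u u p = 0 :=
    le_antisymm ((nonlocal_le_energy u).trans h0.le) (nonlocal_self_nonneg u)
  rw [setIntegral_eq_zero_iff_of_nonneg_ae
    (Eventually.of_forall (nonlocalIntegrand_self_nonneg u)) hint.integrableOn] at hQ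
  have hQm : MeasurableSet (setQ Ω) :=
    (hΩ.measurableSet.compl.prod hΩ.measurableSet.compl).compl
  have h1 : ∀ᵐ p : RSpace n × RSpace n, p ∈ setQ Ω → nonlocalIntegrand s u u p = 0 :=
    (ae_restrict_iff' hQm).1 hQ
  have h2 : ∀ᵐ x : RSpace n, ∀ᵐ y : RSpace n,
      (x, y) ∈ setQ Ω → nonlocalIntegrand s u u (x, y) = 0 :=
    Measure.ae_ae_of_ae_prod h1
  -- As `Ω` has positive measure, it contains a point `x` good for almost every `y`; all pairs `(x,
  -- y)` then lie in `Q`.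
  obtain ⟨x, hxy, hx⟩ := Frequently.exists ((frequently_ae_mem_iff.2
    (hΩ.measure_pos volume hne).ne').and_eventually h2 |>.mono fun x h => h.symm)
  have h5 : u =ᵐ[volume] fun _ => u x := by
    filter_upwards [hxy] with y hy
    have h6 := hy fun hq => hq.1 hx
    rcases eq_or_ne x y with rfl | hne'
    · rfl
    have hpos : 0 < ‖x - y‖ ^ ((n : ℝ) + 2 * s) :=
      Real.rpow_pos_of_pos (norm_pos_iff.2 (sub_ne_zero.2 hne')) _
    simp only [nonlocalIntegrand, div_eq_zero_iff, hpos.ne', or_false, mul_self_eq_zero] at h6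
    exact (sub_eq_zero.1 h6).symm
  -- For `n ≥ 1` the whole space has infinite measure, so a nonzero constant is not in `L²`.
  have : Nonempty (Fin n) := ⟨⟨0, hn⟩⟩
  have h7 : MemLp (fun _ : RSpace n => u x) 2 volume := (memLp_congr_ae h5).1 (Lp.memLp u)
  rw [memLp_const_iff (by norm_num) (by norm_num)] at h7
  have h8 : u x = 0 := h7.resolve_right (by simp)
  exact Lp.eq_zero_iff_ae_eq_zero.2 (by rw [h8] at h5; exact h5)

/-- The integral over a set of finite measure as a linear form on `X`. -/
noncomputable def setIntegralForm (Ω N : Set (RSpace n)) {B : Set (RSpace n)}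
    (hB : volume B ≠ ⊤) : submoduleX Ω N →ₗ[ℝ] ℝ where
  toFun u := ∫ y in B, (u : L2 n) y
  map_add' u v := by
    have hi : ∀ w : L2 n, IntegrableOn w B := fun w =>
      integrableOn_Lp_of_measure_ne_top w fact_one_le_two_ennreal.elim hB
    rw [← integral_add (hi u) (hi v)]
    refine integral_congr_ae (ae_restrict_of_ae ?_)
    filter_upwards [Lp.coeFn_add (u : L2 n) v] with x hx
    rw [Submodule.coe_add, hx, Pi.add_apply]
  map_smul' c u := by
    rw [RingHom.id_apply, smul_eq_mul, ← integral_const_mul]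
    refine integral_congr_ae (ae_restrict_of_ae ?_)
    filter_upwards [Lp.coeFn_smul c (u : L2 n)] with x hx
    rw [Submodule.coe_smul, hx, Pi.smul_apply, smul_eq_mul]

/-- Finitely many linear conditions make the mass small with respect to the energy. -/
theorem exists_linearMap_massForm_le (hn : 1 ≤ n) (hs0 : 0 < s) (hs1 : s < 1)
    (hΩ : IsOpen Ω) (hN : IsOpen N) (hbdd : Bornology.IsBounded Ω) (ε : ℝ) (hε : 0 < ε) :
    ∃ (ι : Type) (_ : Finite ι) (T : submoduleX Ω N →ₗ[ℝ] (ι → ℝ)),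
      ∀ u, T u = 0 → massForm Ω N u u ≤ ε * energyForm hn hs0 hs1 hΩ hN u u := by
  obtain ⟨r, hr, hrε⟩ := exists_radius_le (n := n) hs0 hε
  obtain ⟨t, -, ht, hcover⟩ := finite_cover_balls_of_compact hbdd.isCompact_closure hr
  -- One condition per ball of the cover: the integral of `u` over it vanishes.
  refine ⟨t, ht, LinearMap.pi fun c => setIntegralForm Ω N
    (B := Metric.ball (c : RSpace n) r) measure_ball_lt_top.ne, fun u hu => ?_⟩
  rw [massForm_self]
  have h1 := setIntegral_sq_le_of_setIntegral_ball_eq_zero hs0 hΩ.measurableSet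
    (Lp.memLp (u : L2 n))
    (integrable_nonlocalIntegrand_of_mem_spaceX hn hs0 hs1 hΩ hN u.2 u.2) hr
    (subset_closure.trans hcover) fun c hc => congrFun hu ⟨c, hc⟩
  exact h1.trans (mul_le_mul hrε (nonlocal_le_energy _) (nonlocal_self_nonneg _) hε.le)

end forms

/-! ### Transfer between the forms on `X` and the concrete statements. -/

section transfer

variable {n : ℕ} {s : ℝ} {Ω N : Set (RSpace n)}

theorem eigenSet_eq_map (hn : 1 ≤ n) (hs0 : 0 < s) (hs1 : s < 1) (hΩ : IsOpen Ω)
    (hN : IsOpen N) (μ : ℝ) :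
    ((relEigenspace (energyForm hn hs0 hs1 hΩ hN) (massForm Ω N) μ).map
      (submoduleX Ω N).subtype : Set (L2 n)) = eigenSet s Ω N μ := by
  ext u
  constructor
  · rintro ⟨v, hv, rfl⟩
    exact ⟨v.2, fun φ hφ => mem_relEigenspace.1 hv ⟨φ, hφ⟩⟩
  · rintro ⟨hu, h⟩
    exact ⟨⟨u, hu⟩, mem_relEigenspace.2 fun φ => h φ φ.2, rfl⟩

theorem finiteDimensional_relEigenspace_energyForm (hn : 1 ≤ n) (hs0 : 0 < s) (hs1 : s < 1)
    (hΩ : IsOpen Ω) (hne : Ω.Nonempty) (hN : IsOpen N) (hbdd : Bornology.IsBounded Ω) (μ : ℝ) :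
    FiniteDimensional ℝ (relEigenspace (energyForm hn hs0 hs1 hΩ hN) (massForm Ω N) μ) :=
  finiteDimensional_relEigenspace massForm_self_nonneg
    (fun u h => Subtype.ext (eq_zero_of_energy_self_eq_zero hn hs0 hs1 hΩ hne hN u.2 h))
    (exists_linearMap_massForm_le hn hs0 hs1 hΩ hN hbdd) μ

theorem hasFiniteMultiplicity (hn : 1 ≤ n) (hs0 : 0 < s) (hs1 : s < 1) (hΩ : IsOpen Ω)
    (hne : Ω.Nonempty) (hN : IsOpen N) (hbdd : Bornology.IsBounded Ω) (μ : ℝ) :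
    HasFiniteMultiplicity s Ω N μ := by
  have := finiteDimensional_relEigenspace_energyForm hn hs0 hs1 hΩ hne hN hbdd μ
  exact ⟨_, eigenSet_eq_map hn hs0 hs1 hΩ hN μ, inferInstance⟩

/-- Successive minimization of the energy in the abstract setting. The term of index `0` is
replaced by `0`, so that all terms belong to `X`. -/
theorem IsMinimizingSystem.exists_isRelMinimizing (hn : 1 ≤ n) (hs0 : 0 < s) (hs1 : s < 1)
    (hΩ : IsOpen Ω) (hN : IsOpen N) {lam : ℕ → ℝ} {e : ℕ → L2 n}
    (h : IsMinimizingSystem s Ω N lam e) :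
    ∃ f : ℕ → submoduleX Ω N, (∀ k, 1 ≤ k → (f k : L2 n) = e k) ∧
      IsRelMinimizing (energyForm hn hs0 hs1 hΩ hN) (massForm Ω N) lam f := by
  have hmem : ∀ k, 1 ≤ k → e k ∈ submoduleX Ω N := fun k hk => (h k hk).1.1
  have hf : ∀ k, ∃ v : submoduleX Ω N, 1 ≤ k → (v : L2 n) = e k := fun k => by
    by_cases hk : 1 ≤ k
    · exact ⟨⟨e k, hmem k hk⟩, fun _ => rfl⟩
    · exact ⟨0, fun hk' => absurd hk' hk⟩
  choose f hf using hf
  have henergy : ∀ u v, energyForm hn hs0 hs1 hΩ hN u v = energy s Ω (u : L2 n) v :=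
    fun _ _ => rfl
  refine ⟨f, hf, fun k hk => ?_⟩
  obtain ⟨⟨-, h1⟩, h2, h3, h4⟩ := h k hk
  refine ⟨fun j hj hjk => ?_, ?_, ?_, fun u hu hu1 => ?_⟩
  · rw [henergy, hf k hk, hf j hj]
    exact h1 j hj hjk
  · rw [massForm_self, hf k hk]
    exact h2
  · rw [henergy, hf k hk]
    exact h3
  · refine h4 u ⟨u.2, fun j hj hjk => ?_⟩ (by rwa [massForm_self] at hu1)
    have := hu j hj hjk
    rwa [henergy, hf j hj] at this

end transfer

theorem mainTheorem4 (n : ℕ) (hn : 1 ≤ n) (s : ℝ) (hs0 : 0 < s) (hs1 : s < 1)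
    (Ω D N : Set (RSpace n)) (hset : IsMixedSetting Ω D N) :
    (∀ μ : ℝ, IsMixedEigenvalue s Ω N μ → HasFiniteMultiplicity s Ω N μ) ∧
    ∀ (lam : ℕ → ℝ) (e : ℕ → L2 n), IsMinimizingSystem s Ω N lam e →
      (∀ k, 1 ≤ k → IsMixedEigenvalue s Ω N (lam k) ∧ HasFiniteMultiplicity s Ω N (lam k) ∧
        {j : ℕ | 1 ≤ j ∧ lam j = lam k}.Finite) ∧
      ∀ k h : ℕ, 1 ≤ k → (2 ≤ k → lam (k - 1) < lam k) →
        (∀ j, k ≤ j → j ≤ k + h → lam j = lam k) → lam (k + h) < lam (k + h + 1) →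
        eigenSet s Ω N (lam k) =
          (Submodule.span ℝ (e '' Set.Icc k (k + h)) : Set (L2 n)) := by
  have hΩ := hset.isOpen_domain
  have hN := hset.isOpen_neumann
  have hne := hset.nonempty_domain
  have hbdd := hset.isBounded.subset (subset_union_left (s := Ω) (t := N))
  have hfin := hasFiniteMultiplicity hn hs0 hs1 hΩ hne hN hbdd
  refine ⟨fun μ _ => hfin μ, fun lam e he => ?_⟩
  obtain ⟨f, hf, hmin⟩ := he.exists_isRelMinimizing hn hs0 hs1 hΩ hN
  have hsymm : ∀ u v, energyForm hn hs0 hs1 hΩ hN u v = energyForm hn hs0 hs1 hΩ hN v u :=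
    fun u v => energy_comm _ _
  have ha : ∀ u, 0 ≤ energyForm hn hs0 hs1 hΩ hN u u := fun u => energy_self_nonneg _
  have hpos : ∀ u, energyForm hn hs0 hs1 hΩ hN u u = 0 → u = 0 := fun u h =>
    Subtype.ext (eq_zero_of_energy_self_eq_zero hn hs0 hs1 hΩ hne hN u.2 h)
  refine ⟨fun k hk => ⟨⟨e k, ?_, ?_⟩, hfin _, ?_⟩, fun k h hk hlt heq hlt' => ?_⟩
  · rw [← eigenSet_eq_map hn hs0 hs1 hΩ hN, ← hf k hk]
    exact ⟨f k, hmin.mem_relEigenspace hsymm massForm_comm ha massForm_self_nonneg hpos k hk, rfl⟩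
  · intro h0
    rw [← hf k hk, Submodule.coe_eq_zero] at h0
    simpa [h0] using (hmin k hk).2.1
  · have := finiteDimensional_relEigenspace_energyForm hn hs0 hs1 hΩ hne hN hbdd (lam k)
    exact hmin.finite_setOf_eq hsymm massForm_comm ha massForm_self_nonneg hpos (lam k)
  · rw [← eigenSet_eq_map hn hs0 hs1 hΩ hN, hmin.relEigenspace_eq_span hsymm massForm_comm ha
      massForm_self_nonneg hpos hk hlt heq hlt', Submodule.map_span, ← image_comp]
    congr 2
    -- `f` is only known to agree with `e` from index `1` on, which `1 ≤ k` ensures here.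
    exact image_congr fun j hj => hf j (hk.trans hj.1)
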